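/- Let $\Sigma$ be a non-empty finite alphabet. A co-Büchi automaton is $\mathcal A=(Q,Q_{\mathit{init}},\Sigma,\Delta)$ with $Q$ finite, $Q_{\mathit{init}}\subseteq Q$ and $\Delta\subseteq Q\times\Sigma\times\{1,2\}\times Q$, such that every state has at least one outgoing transition on every letter. It accepts $w\in\Sigma^\omega$ if some run on $w$ from a state of $Q_{\mathit{init}}$ takes only finitely many transitions of rank $1$; $L(\mathcal A)$ is the set of accepted words, and a co-Büchi language is a set of the form $L(\mathcal A)$. The automaton $\mathcal A$ is history-deterministic if Eve wins the following game: Eve puts a token on an initial state; in each round Adam chooses a letter and Eve moves the token along a transition on that letter; Eve wins if the resulting run takes only finitely many transitions of rank $1$ or the word chosen by Adam is not in $L(\mathcal A)$. Let $L\subseteq\Sigma^\omega$ be a co-Büchi language. For $u,v\in\Sigma^*$ define: - $u\sim_L v$ if for all $w\in\Sigma^\omega$: $uw\in L$ iff $vw\in L$; - $(u,v)\approx_L\bot$ if $v\neq\varepsilon$ and $u(vx)^\omega\notin L$ for all $x\in\Sigma^*$ with $uvx\sim_L u$; - $S(u,v)=\{x\in\Sigma^* : (u,vx)\not\approx_L\bot\}$;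 - $(u,v)\equiv_L(u',v')$ if $uv\sim_L u'v'$ and $S(u,v)=S(u',v')$; the class of $(u,v)$ is $[u,v]$; - $(u,v)$ is pointed if $(u,v)\not\approx_L\bot$ and, for all $u_1,u_2\in\Sigma^*$ with $u_1u_2\sim_L u$ and $(u_1,u_2v)\not\approx_L\bot$, $S(u,v)=S(u_1,u_2v)$. The canonical automaton $\mathcal A_{\equiv_L}$ has as states the classes $[u,v]$ of pointed pairs $(u,v)$; its initial states are the classes $[u,v]$ with $(u,v)$ pointed and $uv\sim_L\varepsilon$; for pointed $(u,v)$, $(u',v')$ and $a\in\Sigma$, it has a transition of rank $2$ on $a$ from $[u,v]$ to $[u,va]$ whenever $(u,va)\not\approx_L\bot$, and a transition of rank $1$ on $a$ from $[u,v]$ to $[u',v']$ whenever $uva\sim_L u'v'$. Theorem. $\mathcal A_{\equiv_L}$ is a minimal history-deterministic co-Büchi automaton for $L$: it is a co-Büchi automaton (in particular it has finitely many states), it is history-deterministic, $L(\mathcal A_{\equiv_L})=L$, and every history-deterministic co-Büchi automaton $\mathcal B$ with $L(\mathcal B)=L$ has at least as many states as $\mathcal A_{\equiv_L}$. -/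

import Mathlib

namespace CoBuchi

/-- The rank of a transition. -/
inductive Rank where
  | one
  | two

/-- The data of a transition-based (nondeterministic) co-Büchi automaton over the alphabet `α`
with states in `Q`: initial states and ranked transitions `p --a:i--> q`. Finiteness and totality
are the predicate `IsCoBuchi` below. -/
structure Automaton (α : Type*) (Q : Type*) where
  init : Set Q
  trans : Q → α → Rank → Q → Prop

namespace Automaton

variable {α Q : Type*} (A : Automaton α Q)

/-- The automaton has finitely many states, and from every state there is an outgoing transition
on every letter. -/
def IsCoBuchi : Prop :=
  Finite Q ∧ ∀ p a, ∃ i q, A.trans p a i q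

/-- `st` and `rk` (visited states and ranks of the transitions taken) form a run on `w`
starting in `q₀`. -/
def IsRun (q₀ : Q) (w : Stream' α) (st : ℕ → Q) (rk : ℕ → Rank) : Prop :=
  st 0 = q₀ ∧ ∀ n, A.trans (st n) (w.get n) (rk n) (st (n + 1))

/-- Co-Büchi acceptance: only finitely many transitions of rank `1`. -/
def Accepting (rk : ℕ → Rank) : Prop :=
  {n | rk n = Rank.one}.Finite

/-- The infinite words accepted by the automaton. -/
def language : Set (Stream' α) :=
  {w | ∃ q₀ ∈ A.init, ∃ st rk, A.IsRun q₀ w st rk ∧ Accepting rk}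

/-- The states visited when Eve starts in `q₀`, Adam plays the letters of `w`, and Eve answers
the letter `a` played after the word `x` by the rank and target state `σ x a`. -/
def playState (q₀ : Q) (σ : List α → α → Rank × Q) (w : Stream' α) : ℕ → Q
  | 0 => q₀
  | n + 1 => (σ (w.take n) (w.get n)).2

/-- The ranks of the transitions which Eve takes in the same play. -/
def playRank (σ : List α → α → Rank × Q) (w : Stream' α) (n : ℕ) : Rank :=
  (σ (w.take n) (w.get n)).1

/-- History-determinism: Eve can choose an initial state and a strategy, depending only on the
letters played so far, which always moves along transitions of the automaton, and which produces
an accepting run on every word of the language. -/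
def HistoryDeterministic : Prop :=
  ∃ q₀ ∈ A.init, ∃ σ : List α → α → Rank × Q, ∀ w : Stream' α,
    A.IsRun q₀ w (playState q₀ σ w) (playRank σ w) ∧
      (w ∈ A.language → Accepting (playRank σ w))

/-- `A` is a history-deterministic co-Büchi automaton that accepts exactly `L`. -/
def IsHDFor (L : Set (Stream' α)) : Prop :=
  A.IsCoBuchi ∧ A.HistoryDeterministic ∧ A.language = L

end Automaton

/-- A co-Büchi language: the language of some (nondeterministic) co-Büchi automaton. As state
sets are finite, it is enough to consider those in `Type`. -/
def IsCoBuchiLanguage {α : Type*} (L : Set (Stream' α)) : Prop :=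
  ∃ (Q : Type) (A : Automaton α Q), A.IsCoBuchi ∧ A.language = L

section Canonical

variable {α : Type*} (L : Set (Stream' α))

/-- The right congruence `u ∼_L v`. -/
def RightCongr (u v : List α) : Prop :=
  ∀ w : Stream' α, (u ++ₛ w) ∈ L ↔ (v ++ₛ w) ∈ L

/-- `(u, v) ≈_L ⊥`: `v` is non-empty and `u (v x)^ω ∉ L` for all `x` with `u v x ∼_L u`.
(`Stream'.cycle` takes a proof `h` that the repeated word is non-empty; it exists as `v` is.) -/
def EquivBot (u v : List α) : Prop :=
  v ≠ [] ∧ ∀ (x : List α) (h : v ++ x ≠ []),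
    RightCongr L (u ++ v ++ x) u → (u ++ₛ Stream'.cycle (v ++ x) h) ∉ L

/-- The safe extensions `{x | (u, v x) ≉_L ⊥}` of a pair. -/
def safeExt (u v : List α) : Set (List α) :=
  {x | ¬ EquivBot L u (v ++ x)}

/-- The equivalence `≡_L` on pairs of finite words. -/
def pairSetoid : Setoid (List α × List α) where
  r p q := RightCongr L (p.1 ++ p.2) (q.1 ++ q.2) ∧ safeExt L p.1 p.2 = safeExt L q.1 q.2
  iseqv :=
    ⟨fun _ => ⟨fun _ => Iff.rfl, rfl⟩,
      fun h => ⟨fun w => (h.1 w).symm, h.2.symm⟩,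
      fun h k => ⟨fun w => (h.1 w).trans (k.1 w), h.2.trans k.2⟩⟩

/-- The `≡_L`-class of the pair `(u, v)`. -/
def cls (u v : List α) : Quotient (pairSetoid L) :=
  Quotient.mk (pairSetoid L) (u, v)

/-- Pointed pairs. -/
def Pointed (u v : List α) : Prop :=
  ¬ EquivBot L u v ∧ ∀ u₁ u₂ : List α, RightCongr L (u₁ ++ u₂) u → ¬ EquivBot L u₁ (u₂ ++ v) →
    safeExt L u v = safeExt L u₁ (u₂ ++ v)

/-- The states of the canonical automaton: the `≡_L`-classes of pointed pairs. -/
def CanonicalState : Type _ :=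
  {c : Quotient (pairSetoid L) // ∃ u v, Pointed L u v ∧ c = cls L u v}

/-- The canonical automaton of `L`. -/
def canonical : Automaton α (CanonicalState L) where
  init := {c | ∃ u v, Pointed L u v ∧ c.1 = cls L u v ∧ RightCongr L (u ++ v) []}
  trans p a i q :=
    match i with
    | Rank.two => ∃ u v, Pointed L u v ∧ p.1 = cls L u v ∧
        ¬ EquivBot L u (v ++ [a]) ∧ q.1 = cls L u (v ++ [a])
    | Rank.one => ∃ u v u' v', Pointed L u v ∧ p.1 = cls L u v ∧
        Pointed L u' v' ∧ q.1 = cls L u' v' ∧ RightCongr L (u ++ v ++ [a]) (u' ++ v')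

end Canonical

end CoBuchi

namespace CoBuchi

open Filter

/-! Call a finite word safe after u if it is not bad in the sense of `EquivBot`. Membership in L is
governed by safety: if every prefix of w is safe after u then uw ∈ L (`append_mem_of_not_equivBot`,
by pigeonhole and Kőnig's lemma), and every word of L has a tail all of whose prefixes are safe
after the part cut off (`exists_not_equivBot`). The class of a pair depends only on finite data of
an automaton for L, so there are finitely many classes, and minimal sets of safe extensions yield
pointed pairs.

A rank-2 run of the canonical automaton keeps every prefix safe, so it accepts only words of L.
Conversely, Eve follows the oldest candidate (a state started at some past position) that is still
safe, and takes rank 1 only when it dies. On a word of L some candidate never dies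
(`exists_pointed_of_mem`), so she changes finitely often.

For minimality, let Eve win on B. Each pointed pair has a state of B to which her strategy can
return along safe transitions after any safe extension (`exists_recurrent`). If two pairs share this
state, their loops there can be concatenated, so their residuals and safe extensions agree. The map
from canonical states to states of B is therefore injective. -/

theorem exists_frequently_of_finite {ι : Type*} [Finite ι] {P : ι → ℕ → Prop}
    (h : ∀ n, ∃ i, P i n) : ∃ i, ∀ N, ∃ n, N ≤ n ∧ P i n := by
  have h1 : ∃ᶠ n in atTop, ∃ i, P i n := Frequently.of_forall h
  rw [frequently_exists] at h1
  obtain ⟨i, hi⟩ := h1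
  rw [frequently_atTop] at hi
  exact ⟨i, fun N => hi N⟩

/-! ### Powers, periodic words and limits of prefixes -/

section Words

variable {α : Type*}

/-- The `k`-th power of a word. -/
def wpow (k : ℕ) (z : List α) : List α :=
  (List.replicate k z).flatten

@[simp] theorem wpow_zero (z : List α) : wpow 0 z = [] := rfl

theorem wpow_succ (k : ℕ) (z : List α) : wpow (k + 1) z = z ++ wpow k z := by
  simp [wpow, List.replicate_succ]

theorem length_wpow (k : ℕ) (z : List α) : (wpow k z).length = k * z.length := by
  simp [wpow]

theorem eq_wpow_append {z : List α} {s : Stream' α} (h : s = z ++ₛ s) (k : ℕ) :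
    s = wpow k z ++ₛ s := by
  induction k with
  | zero => rfl
  | succ k ih => rw [wpow_succ, Stream'.append_append_stream, ← ih, ← h]

theorem take_length_append (x : List α) (s : Stream' α) : (x ++ₛ s).take x.length = x := by
  have h := Stream'.append_take 0 x s
  rw [Stream'.take_zero, List.append_nil] at h
  exact h.symm

theorem take_append_take_drop (w : Stream' α) (m n : ℕ) :
    w.take m ++ (w.drop m).take n = w.take (m + n) :=
  (Stream'.take_add _ _ _).symm

theorem take_prefix_take (w : Stream' α) {m n : ℕ} (h : m ≤ n) : w.take m <+: w.take n := by
  obtain ⟨k, rfl⟩ := Nat.exists_eq_add_of_le h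
  exact ⟨_, take_append_take_drop w m k⟩

theorem take_append_prefix (x : List α) (s : Stream' α) {n : ℕ} (hn : n ≤ x.length) :
    (x ++ₛ s).take n <+: x := by
  have h := take_prefix_take (x ++ₛ s) hn
  rwa [take_length_append] at h

theorem take_prefix_wpow {z : List α} (hz : z ≠ []) {s : Stream' α} (h : s = z ++ₛ s) (n : ℕ) :
    s.take n <+: wpow n z := by
  rw [eq_wpow_append h n]
  apply take_append_prefix
  rw [length_wpow]
  exact Nat.le_mul_of_pos_right _ (List.length_pos_iff.2 hz)

/-- The first n letters of both words form a prefix of `wpow n z`, so the two words agree up to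
every length. -/
theorem eq_of_eq_append {z : List α} (hz : z ≠ []) {s t : Stream' α} (hs : s = z ++ₛ s)
    (ht : t = z ++ₛ t) : s = t := by
  apply Stream'.take_theorem
  intro n
  have h1 := take_prefix_wpow hz hs n
  have h2 := take_prefix_wpow hz ht n
  exact (List.prefix_of_prefix_length_le h1 h2 (by simp)).eq_of_length (by simp)

theorem cycle_rotate (x y : List α) (h : x ++ y ≠ []) (h' : y ++ x ≠ []) :
    Stream'.cycle (x ++ y) h = x ++ₛ Stream'.cycle (y ++ x) h' := by
  apply eq_of_eq_append h (Stream'.cycle_eq _ _)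
  conv_lhs => rw [Stream'.cycle_eq]
  simp only [Stream'.append_append_stream]

/-- A chain of longer and longer prefixes has a limit. -/
theorem exists_limit (t : ℕ → List α) (hp : ∀ k, t k <+: t (k + 1))
    (hl : ∀ k, (t k).length < (t (k + 1)).length) :
    ∃ w : Stream' α, ∀ k, w.take (t k).length = t k := by
  have hmono : ∀ i j, i ≤ j → t i <+: t j := by
    intro i j hij
    induction j, hij using Nat.le_induction with
    | base => exact List.prefix_rfl
    | succ j _ ih => exact ih.trans (hp j)
  have hlen : ∀ k, k ≤ (t k).length := by
    intro k
    induction k with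
    | zero => simp
    | succ k ih => have := hl k; omega
  have hlt : ∀ n, n < (t (n + 1)).length := fun n => hlen (n + 1)
  let w : Stream' α := fun n => (t (n + 1))[n]'(hlt n)
  refine ⟨w, fun k => ?_⟩
  apply List.ext_getElem (Stream'.length_take _ _)
  intro n h1 h2
  have h3 := Stream'.getElem?_take (s := w) h2
  rw [List.getElem?_eq_getElem h1] at h3
  rw [Option.some_inj.1 h3]
  change (t (n + 1))[n]'(hlt n) = _
  rcases le_total k (n + 1) with h | h
  · exact ((hmono _ _ h).getElem h2).symm
  · exact ((hmono _ _ h).getElem (hlt n))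

end Words

/-! ### Finite paths and Kőnig's lemma -/

section Paths

variable {α Q : Type*}

/-- Finite paths in a labelled graph. -/
def Path (T : Q → α → Q → Prop) : Q → List α → Q → Prop
  | p, [], q => p = q
  | p, a :: x, q => ∃ r, T p a r ∧ Path T r x q

variable {T : Q → α → Q → Prop}

@[simp] theorem path_nil {p q : Q} : Path T p [] q ↔ p = q := Iff.rfl

theorem path_append {p q : Q} {x y : List α} :
    Path T p (x ++ y) q ↔ ∃ r, Path T p x r ∧ Path T r y q := by
  induction x generalizing p with
  | nil => simp
  | cons a x ih =>
    simp only [List.cons_append, Path, ih]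
    constructor
    · rintro ⟨r, h, s, h1, h2⟩
      exact ⟨s, ⟨r, h, h1⟩, h2⟩
    · rintro ⟨s, ⟨r, h, h1⟩, h2⟩
      exact ⟨r, h, s, h1, h2⟩

theorem Path.trans {p q r : Q} {x y : List α} (h : Path T p x q) (h' : Path T q y r) :
    Path T p (x ++ y) r :=
  path_append.2 ⟨q, h, h'⟩

theorem Path.exists_of_prefix {p q : Q} {x y : List α} (h : Path T p x q) (hy : y <+: x) :
    ∃ r, Path T p y r := by
  obtain ⟨z, rfl⟩ := hy
  obtain ⟨r, hr, -⟩ := path_append.1 h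
  exact ⟨r, hr⟩

theorem Path.wpow {p : Q} {x : List α} (h : Path T p x p) (k : ℕ) :
    Path T p (wpow k x) p := by
  induction k with
  | zero => rfl
  | succ k ih => rw [wpow_succ]; exact h.trans ih

theorem path_of_seq {st : ℕ → Q} {w : Stream' α} {N : ℕ}
    (h : ∀ n, N ≤ n → T (st n) (w.get n) (st (n + 1))) (m : ℕ) :
    Path T (st N) ((w.drop N).take m) (st (N + m)) := by
  induction m with
  | zero => rfl
  | succ m ih =>
    rw [Stream'.take_succ', Stream'.get_drop]
    exact ih.trans ⟨_, h _ (by omega), rfl⟩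

/-- **Kőnig's lemma** for paths over a fixed infinite word. -/
theorem exists_seq_of_paths [Finite Q] {q : Q} {w : Stream' α}
    (h : ∀ n, ∃ p, Path T q (w.take n) p) :
    ∃ st : ℕ → Q, st 0 = q ∧ ∀ n, T (st n) (w.get n) (st (n + 1)) := by
  have step : ∀ (q : Q) (w : Stream' α), (∀ n, ∃ p, Path T q (w.take n) p) →
      ∃ r, T q (w.get 0) r ∧ ∀ n, ∃ p, Path T r (w.tail.take n) p := by
    intro q w h
    have h1 : ∀ n, ∃ r, T q (w.get 0) r ∧ ∃ p, Path T r (w.tail.take n) p := by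
      intro n
      obtain ⟨p, r, h1, h2⟩ := h (n + 1)
      exact ⟨r, h1, p, h2⟩
    -- A successor that serves infinitely many lengths serves all of them, since paths restrict to
    -- prefixes.
    obtain ⟨r, hr⟩ := exists_frequently_of_finite h1
    refine ⟨r, (hr 0).choose_spec.2.1, fun n => ?_⟩
    obtain ⟨m, hm, -, p, hp⟩ := hr n
    exact hp.exists_of_prefix (take_prefix_take _ hm)
  choose! f hf using step
  let st : ℕ → Q := fun n => Nat.rec q (fun n p => f p (w.drop n)) n
  have key : ∀ n, ∀ m, ∃ p, Path T (st n) ((w.drop n).take m) p := by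
    intro n
    induction n with
    | zero => exact h
    | succ n ih =>
      have := (hf _ _ ih).2
      rwa [Stream'.tail_drop'] at this
  refine ⟨st, rfl, fun n => ?_⟩
  have := (hf _ _ (key n)).1
  rwa [Stream'.get_drop] at this

end Paths

/-! ### Runs, reachable states and lassos -/

namespace Automaton

variable {α Q : Type*} (A : Automaton α Q)

/-- The transitions with their ranks forgotten. -/
def step (p : Q) (a : α) (q : Q) : Prop := ∃ i, A.trans p a i q

/-- The transitions of rank `2`. -/
def safeStep (p : Q) (a : α) (q : Q) : Prop := A.trans p a Rank.two q

/-- The words with an accepting run from the given state. -/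
def AccFrom (q : Q) (w : Stream' α) : Prop :=
  ∃ st rk, A.IsRun q w st rk ∧ Accepting rk

/-- The states reachable from an initial state. -/
def reach (u : List α) : Set Q :=
  {q | ∃ q₀ ∈ A.init, Path A.step q₀ u q}

variable {A}

theorem mem_reach_append {u v : List α} {q : Q} :
    q ∈ A.reach (u ++ v) ↔ ∃ p ∈ A.reach u, Path A.step p v q := by
  simp only [reach, path_append, Set.mem_ofPred_eq]
  constructor
  · rintro ⟨q₀, h, r, h1, h2⟩
    exact ⟨r, ⟨q₀, h, h1⟩, h2⟩
  · rintro ⟨r, ⟨q₀, h, h1⟩, h2⟩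
    exact ⟨q₀, h, r, h1, h2⟩

theorem AccFrom.cons {p q : Q} {a : α} {w : Stream' α} (h : A.step p a q) (hq : A.AccFrom q w) :
    A.AccFrom p (Stream'.cons a w) := by
  obtain ⟨i, hi⟩ := h
  obtain ⟨st, rk, ⟨h0, h1⟩, hacc⟩ := hq
  refine ⟨fun n => Nat.casesOn n p st, fun n => Nat.casesOn n i rk, ⟨rfl, ?_⟩, ?_⟩
  · rintro (_ | n)
    · show A.trans p a i (st 0)
      rwa [h0]
    · exact h1 n
  · refine ((hacc.image Nat.succ).insert 0).subset ?_
    rintro (_ | n) hn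
    · simp
    · exact Or.inr ⟨n, hn, rfl⟩

theorem AccFrom.append {p q : Q} {x : List α} {w : Stream' α} (h : Path A.step p x q)
    (hq : A.AccFrom q w) : A.AccFrom p (x ++ₛ w) := by
  induction x generalizing p with
  | nil => cases h; exact hq
  | cons a x ih =>
    obtain ⟨r, h1, h2⟩ := h
    exact (ih h2).cons h1

theorem AccFrom.append_mem {q : Q} {u : List α} {w : Stream' α} (hq : A.AccFrom q w)
    (h : q ∈ A.reach u) : u ++ₛ w ∈ A.language := by
  obtain ⟨q₀, h0, h⟩ := h
  exact ⟨q₀, h0, hq.append h⟩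

theorem IsRun.path_take {q₀ : Q} {w : Stream' α} {st : ℕ → Q} {rk : ℕ → Rank}
    (h : A.IsRun q₀ w st rk) (n : ℕ) : Path A.step q₀ (w.take n) (st n) := by
  have h1 := path_of_seq (T := A.step) (N := 0) (fun k _ => ⟨_, h.2 k⟩) n
  rwa [Stream'.drop_zero, zero_add, h.1] at h1

theorem IsRun.path_safe {q₀ : Q} {w : Stream' α} {st : ℕ → Q} {rk : ℕ → Rank}
    (h : A.IsRun q₀ w st rk) {N : ℕ} (hN : ∀ n, N ≤ n → rk n = Rank.two) {n : ℕ} (hn : N ≤ n)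
    (m : ℕ) : Path A.safeStep (st n) ((w.drop n).take m) (st (n + m)) := by
  refine path_of_seq (fun k hk => ?_) m
  have h1 := h.2 k
  rwa [hN k (hn.trans hk)] at h1

theorem IsRun.accFrom {q₀ : Q} {u : List α} {w : Stream' α} {st : ℕ → Q} {rk : ℕ → Rank}
    (h : A.IsRun q₀ (u ++ₛ w) st rk) (hacc : Accepting rk) : A.AccFrom (st u.length) w := by
  refine ⟨fun n => st (u.length + n), fun n => rk (u.length + n), ⟨rfl, fun n => ?_⟩, ?_⟩
  · have h1 := h.2 (u.length + n)
    rwa [← Stream'.get_drop, Stream'.drop_append_stream] at h1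
  · exact hacc.preimage (f := fun n => u.length + n) (fun _ _ _ _ h => by simpa using h)

theorem append_mem_language_iff {u : List α} {w : Stream' α} :
    u ++ₛ w ∈ A.language ↔ ∃ q ∈ A.reach u, A.AccFrom q w := by
  refine ⟨?_, fun ⟨q, h, hq⟩ => hq.append_mem h⟩
  rintro ⟨q₀, h0, st, rk, hrun, hacc⟩
  refine ⟨st u.length, ⟨q₀, h0, ?_⟩, hrun.accFrom hacc⟩
  have h1 := hrun.path_take u.length
  rwa [take_length_append] at h1

theorem Accepting.exists_forall {rk : ℕ → Rank} (h : Accepting rk) :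
    ∃ N, ∀ n, N ≤ n → rk n = Rank.two := by
  obtain ⟨N, hN⟩ := h.bddAbove
  refine ⟨N + 1, fun n hn => ?_⟩
  cases hr : rk n with
  | two => rfl
  | one => exact absurd (hN hr) (by omega)

theorem accepting_of_forall {rk : ℕ → Rank} {N : ℕ} (h : ∀ n, N ≤ n → rk n = Rank.two) :
    Accepting rk := by
  refine (Set.finite_lt_nat N).subset fun n hn => ?_
  by_contra hc
  have h1 := h n (not_lt.1 hc)
  have h2 : rk n = Rank.one := hn
  rw [h2] at h1
  cases h1

theorem accFrom_of_safe [Finite Q] {q : Q} {w : Stream' α}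
    (h : ∀ n, ∃ p, Path A.safeStep q (w.take n) p) : A.AccFrom q w := by
  obtain ⟨st, h0, h1⟩ := exists_seq_of_paths h
  exact ⟨st, fun _ => Rank.two, ⟨h0, h1⟩, accepting_of_forall (N := 0) fun _ _ => rfl⟩

theorem accFrom_cycle [Finite Q] {q : Q} {z : List α} (hz : z ≠ [])
    (h : Path A.safeStep q z q) : A.AccFrom q (Stream'.cycle z hz) :=
  accFrom_of_safe fun n =>
    (h.wpow n).exists_of_prefix (take_prefix_wpow hz (Stream'.cycle_eq _ _) n)

/-- Acceptance of ultimately periodic words in terms of lassos. -/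
theorem append_cycle_mem_iff [Finite Q] {u z : List α} (hz : z ≠ []) :
    u ++ₛ Stream'.cycle z hz ∈ A.language ↔
      ∃ q ∈ A.reach u, ∃ i p j, Path A.step q (wpow i z) p ∧
        Path A.safeStep p (wpow (j + 1) z) p := by
  rw [append_mem_language_iff]
  have hc := Stream'.cycle_eq z hz
  have hl : 0 < z.length := List.length_pos_iff.2 hz
  constructor
  · rintro ⟨q, hq, st, rk, hrun, hacc⟩
    refine ⟨q, hq, ?_⟩
    obtain ⟨N, hN⟩ := hacc.exists_forall
    obtain ⟨p, hp⟩ := exists_frequently_of_finite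
      (P := fun p k => st (k * z.length) = p) fun k => ⟨_, rfl⟩
    obtain ⟨i, hi, hip⟩ := hp N
    -- Asking for a visit from i + 1 on makes the cycle non-empty.
    obtain ⟨k, hk, hkp⟩ := hp (i + 1)
    obtain ⟨j, rfl⟩ := Nat.exists_eq_add_of_le hk
    have htake : ∀ k, (Stream'.cycle z hz).take (k * z.length) = wpow k z := by
      intro k
      conv_lhs => rw [eq_wpow_append hc k, ← length_wpow, take_length_append]
    have hdrop : ∀ k, (Stream'.cycle z hz).drop (k * z.length) = Stream'.cycle z hz := by
      intro k
      conv_lhs => rw [eq_wpow_append hc k, ← length_wpow, Stream'.drop_append_stream]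
    refine ⟨i, p, j, ?_, ?_⟩
    · have h3 := hrun.path_take (i * z.length)
      rwa [htake, hip] at h3
    · have h3 := hrun.path_safe hN (hi.trans (Nat.le_mul_of_pos_right _ hl))
        ((j + 1) * z.length)
      rwa [hdrop, htake, hip, ← add_mul, show i + (j + 1) = i + 1 + j by omega, hkp] at h3
  · rintro ⟨q, hq, i, p, j, h1, h2⟩
    refine ⟨q, hq, ?_⟩
    rw [eq_wpow_append hc i]
    refine AccFrom.append h1 (accFrom_of_safe fun n => ?_)
    have hw : wpow (j + 1) z ≠ [] := by
      rw [← List.length_pos_iff, length_wpow]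
      positivity
    exact (h2.wpow n).exists_of_prefix (take_prefix_wpow hw (eq_wpow_append hc _) n)

end Automaton

/-! ### Residuals, safe loops and pointed pairs -/

section Congruence

variable {α : Type*} {L : Set (Stream' α)}

theorem RightCongr.refl (u : List α) : RightCongr L u u := fun _ => Iff.rfl

theorem RightCongr.symm {u v : List α} (h : RightCongr L u v) : RightCongr L v u :=
  fun w => (h w).symm

theorem RightCongr.trans {u v x : List α} (h : RightCongr L u v) (h' : RightCongr L v x) :
    RightCongr L u x :=
  fun w => (h w).trans (h' w)

theorem RightCongr.append {u v : List α} (h : RightCongr L u v) (x : List α) :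
    RightCongr L (u ++ x) (v ++ x) := by
  intro w
  rw [Stream'.append_append_stream, Stream'.append_append_stream]
  exact h _

/-- `z` loops on the class of `u`, and `u z^ω ∈ L`. -/
def Loop (L : Set (Stream' α)) (u z : List α) : Prop :=
  RightCongr L (u ++ z) u ∧ ∃ hz : z ≠ [], (u ++ₛ Stream'.cycle z hz) ∈ L

theorem not_equivBot_iff {u v : List α} :
    ¬ EquivBot L u v ↔ v = [] ∨ ∃ x, Loop L u (v ++ x) := by
  unfold EquivBot Loop
  push Not
  constructor
  · intro h
    by_cases hv : v = []
    · exact Or.inl hv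
    · obtain ⟨x, hx, h1, h2⟩ := h hv
      rw [List.append_assoc] at h1
      exact Or.inr ⟨x, h1, hx, h2⟩
  · rintro (h | ⟨x, h1, hx, h2⟩) hv
    · exact absurd h hv
    · rw [← List.append_assoc] at h1
      exact ⟨x, hx, h1, h2⟩

theorem not_equivBot_nil (u : List α) : ¬ EquivBot L u [] :=
  not_equivBot_iff.2 (Or.inl rfl)

theorem Loop.not_equivBot {u z : List α} (h : Loop L u z) : ¬ EquivBot L u z :=
  not_equivBot_iff.2 (Or.inr ⟨[], by rwa [List.append_nil]⟩)

theorem not_equivBot_of_append {u v x : List α} (h : ¬ EquivBot L u (v ++ x)) :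
    ¬ EquivBot L u v := by
  rw [not_equivBot_iff] at h ⊢
  rcases h with h | ⟨y, h⟩
  · exact Or.inl (List.append_eq_nil_iff.1 h).1
  · exact Or.inr ⟨x ++ y, by rwa [← List.append_assoc]⟩

theorem not_equivBot_of_prefix {u v x : List α} (h : ¬ EquivBot L u x) (hv : v <+: x) :
    ¬ EquivBot L u v := by
  obtain ⟨y, rfl⟩ := hv
  exact not_equivBot_of_append h

/-- The word u₁(xy)^ω equals u₁x(yx)^ω, where u₁x may be replaced by the congruent u. -/
theorem Loop.rotate {u u₁ x y : List α} (hu : RightCongr L (u₁ ++ x) u)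
    (h : Loop L u₁ (x ++ y)) : Loop L u (y ++ x) := by
  obtain ⟨h1, hz, h2⟩ := h
  have hz' : y ++ x ≠ [] := by
    intro h
    rw [List.append_eq_nil_iff] at h
    exact hz (List.append_eq_nil_iff.2 h.symm)
  refine ⟨?_, hz', ?_⟩
  · have h3 := (h1.append x).trans hu
    refine RightCongr.trans ?_ h3
    have h4 := hu.symm.append (y ++ x)
    simpa only [List.append_assoc] using h4
  · rw [cycle_rotate x y hz hz', ← Stream'.append_append_stream] at h2
    exact (hu _).1 h2

theorem not_equivBot_of_congr {u u₁ u₂ v : List α} (hu : RightCongr L (u₁ ++ u₂) u)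
    (h : ¬ EquivBot L u₁ (u₂ ++ v)) : ¬ EquivBot L u v := by
  rw [not_equivBot_iff] at h ⊢
  rcases h with h | ⟨y, h⟩
  · exact Or.inl (List.append_eq_nil_iff.1 h).2
  · refine Or.inr ⟨y ++ u₂, ?_⟩
    rw [List.append_assoc] at h
    rw [← List.append_assoc]
    exact h.rotate hu

theorem mem_safeExt {u v x : List α} : x ∈ safeExt L u v ↔ ¬ EquivBot L u (v ++ x) := Iff.rfl

/-- Moving part of the past into the second component can only remove safe extensions; pointed pairs
are those where nothing more is lost. -/
theorem safeExt_subset {u u₁ u₂ : List α} (hu : RightCongr L (u₁ ++ u₂) u) (v : List α) :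
    safeExt L u₁ (u₂ ++ v) ⊆ safeExt L u v := by
  intro x hx
  rw [mem_safeExt, List.append_assoc] at hx
  exact not_equivBot_of_congr hu hx

theorem safeExt_append {u u' v v' : List α} (h : safeExt L u v = safeExt L u' v') (x : List α) :
    safeExt L u (v ++ x) = safeExt L u' (v' ++ x) := by
  ext y
  have h1 : x ++ y ∈ safeExt L u v ↔ x ++ y ∈ safeExt L u' v' := by rw [h]
  simpa only [mem_safeExt, List.append_assoc] using h1

theorem cls_eq_iff {u v u' v' : List α} :
    cls L u v = cls L u' v' ↔
      RightCongr L (u ++ v) (u' ++ v') ∧ safeExt L u v = safeExt L u' v' :=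
  Quotient.eq

theorem Pointed.append {u v x : List α} (h : Pointed L u v) (hx : ¬ EquivBot L u (v ++ x)) :
    Pointed L u (v ++ x) := by
  refine ⟨hx, fun u₁ u₂ hu hb => ?_⟩
  rw [← List.append_assoc] at hb ⊢
  exact safeExt_append (h.2 u₁ u₂ hu (not_equivBot_of_append hb)) x

end Congruence

/-! ### Safety read off from a finite automaton -/

section Regular

variable {α Q : Type*} {A : Automaton α Q}

open Automaton

theorem congr_of_reach_eq {u u' : List α} (h : A.reach u = A.reach u') :
    RightCongr A.language u u' := by
  intro w
  rw [append_mem_language_iff, append_mem_language_iff, h]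

/-- The information on a pair which determines its class. -/
def profile (A : Automaton α Q) (c : List α × List α) :
    Set Q × (Q → Q → Prop) × (Q → Q → Prop) × Prop :=
  (A.reach c.1, fun p q => Path A.step p c.2 q, fun p q => Path A.safeStep p c.2 q, c.2 = [])

theorem path_append_congr {T : Q → α → Q → Prop} {v v' : List α}
    (h : ∀ p q, Path T p v q ↔ Path T p v' q) (x : List α) (p q : Q) :
    Path T p (v ++ x) q ↔ Path T p (v' ++ x) q := by
  simp only [path_append, h]

theorem path_wpow_congr {T : Q → α → Q → Prop} {v v' : List α}
    (h : ∀ p q, Path T p v q ↔ Path T p v' q) (k : ℕ) (p q : Q) :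
    Path T p (wpow k v) q ↔ Path T p (wpow k v') q := by
  induction k generalizing p with
  | zero => rfl
  | succ k ih => simp only [wpow_succ, path_append, h, ih]

theorem reach_append_congr {u u' v v' : List α} (hu : A.reach u = A.reach u')
    (hv : ∀ p q, Path A.step p v q ↔ Path A.step p v' q) :
    A.reach (u ++ v) = A.reach (u' ++ v') := by
  ext q
  rw [mem_reach_append, mem_reach_append, hu]
  simp only [hv]

variable [Finite Q]

theorem loop_of_path {u z : List α} {q : Q} (hq : q ∈ A.reach u) (h : Path A.safeStep q z q)
    (hz : z ≠ []) (hu : RightCongr A.language (u ++ z) u) : Loop A.language u z :=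
  ⟨hu, hz, (accFrom_cycle hz h).append_mem hq⟩

theorem Loop.congr_wpow {L : Set (Stream' α)} {u z : List α} (h : Loop L u z) (k : ℕ) :
    RightCongr L (u ++ wpow k z) u := by
  induction k with
  | zero => simpa using RightCongr.refl u
  | succ k ih =>
    rw [wpow_succ, ← List.append_assoc]
    exact (h.1.append _).trans ih

/-- The lasso of uz^ω reaches its safe cycle after some z^i, and uz^i is congruent to u because z
loops. -/
theorem Loop.exists_safe {u z : List α} (h : Loop A.language u z) :
    ∃ u' q, RightCongr A.language u' u ∧ q ∈ A.reach u' ∧ ∃ p, Path A.safeStep q z p := by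
  obtain ⟨-, hz, h2⟩ := id h
  obtain ⟨q, hq, i, p, j, h3, h4⟩ := (append_cycle_mem_iff hz).1 h2
  refine ⟨_, p, h.congr_wpow i, mem_reach_append.2 ⟨q, hq, h3⟩, ?_⟩
  rw [wpow_succ] at h4
  exact h4.exists_of_prefix (List.prefix_append _ _)

/-- If no prefix of `v w` is bad after `u`, then `u v w` is in the language. -/
theorem append_mem_of_not_equivBot {u : List α} {w : Stream' α}
    (h : ∀ n, ¬ EquivBot A.language u (w.take n)) : u ++ₛ w ∈ A.language := by
  have h1 : ∀ n, ∃ q, (∃ u', RightCongr A.language u' u ∧ q ∈ A.reach u') ∧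
      ∃ p, Path A.safeStep q (w.take n) p := by
    intro n
    -- Length n + 1 rules out the empty word, which is never bad and gives no loop.
    rcases not_equivBot_iff.1 (h (n + 1)) with h2 | ⟨x, h2⟩
    · cases h2
    · obtain ⟨u', q, h3, h4, p, h5⟩ := h2.exists_safe
      refine ⟨q, ⟨u', h3, h4⟩, h5.exists_of_prefix ?_⟩
      exact (take_prefix_take w n.le_succ).trans (List.prefix_append _ _)
  obtain ⟨q, hq⟩ := exists_frequently_of_finite h1
  obtain ⟨-, -, ⟨u', hu, hr⟩, -⟩ := hq 0
  refine (hu w).1 ((accFrom_of_safe fun n => ?_).append_mem hr)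
  obtain ⟨m, hm, -, p, hp⟩ := hq n
  exact hp.exists_of_prefix (take_prefix_take _ hm)

/-- By the lasso criterion, membership of u v^ω depends only on `A.reach u` and the two path
relations of v. Emptiness is tracked as well, since loops must be non-empty. -/
theorem loop_of_profile_eq {u u' v v' : List α} (hu : A.reach u = A.reach u')
    (h1 : ∀ p q, Path A.step p v q ↔ Path A.step p v' q)
    (h2 : ∀ p q, Path A.safeStep p v q ↔ Path A.safeStep p v' q)
    (hn : v = [] ↔ v' = []) (h : Loop A.language u v) : Loop A.language u' v' := by
  obtain ⟨hc, hz, hm⟩ := h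
  have hz' : v' ≠ [] := fun h => hz (hn.2 h)
  refine ⟨?_, hz', ?_⟩
  · exact ((congr_of_reach_eq (reach_append_congr hu h1)).symm.trans hc).trans
      (congr_of_reach_eq hu)
  · rw [append_cycle_mem_iff] at hm ⊢
    simpa only [hu, path_wpow_congr h1, path_wpow_congr h2] using hm

theorem safeExt_subset_of_profile_eq {c c' : List α × List α} (h : profile A c = profile A c') :
    safeExt A.language c.1 c.2 ⊆ safeExt A.language c'.1 c'.2 := by
  obtain ⟨u, v⟩ := c
  obtain ⟨u', v'⟩ := c'
  simp only [profile, Prod.mk.injEq] at h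
  obtain ⟨hu, h1, h2, hn⟩ := h
  have h1' : ∀ p q, Path A.step p v q ↔ Path A.step p v' q := fun p q =>
    iff_of_eq (congrFun (congrFun h1 p) q)
  have h2' : ∀ p q, Path A.safeStep p v q ↔ Path A.safeStep p v' q := fun p q =>
    iff_of_eq (congrFun (congrFun h2 p) q)
  have hn' := iff_of_eq hn
  intro x hx
  rw [mem_safeExt, not_equivBot_iff] at hx ⊢
  refine hx.imp (fun h => ?_) ?_
  · rw [List.append_eq_nil_iff] at h ⊢
    exact ⟨hn'.1 h.1, h.2⟩
  · rintro ⟨y, hy⟩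
    refine ⟨y, ?_⟩
    rw [List.append_assoc] at hy ⊢
    refine loop_of_profile_eq hu (path_append_congr h1' _) (path_append_congr h2' _) ?_ hy
    change v ++ (x ++ y) = [] ↔ v' ++ (x ++ y) = []
    rw [List.append_eq_nil_iff, hn', ← List.append_eq_nil_iff]

theorem cls_eq_of_profile_eq {c c' : List α × List α} (h : profile A c = profile A c') :
    cls A.language c.1 c.2 = cls A.language c'.1 c'.2 := by
  refine cls_eq_iff.2 ⟨congr_of_reach_eq (reach_append_congr ?_ ?_),
    (safeExt_subset_of_profile_eq h).antisymm (safeExt_subset_of_profile_eq h.symm)⟩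
  · exact congrArg Prod.fst h
  · exact fun p q => iff_of_eq (congrFun (congrFun (congrArg (fun t => t.2.1) h) p) q)

end Regular

/-! ### Finiteness, existence of pointed pairs and safe tails -/

section CoBuchiLanguage

variable {α : Type*} {L : Set (Stream' α)}

theorem IsCoBuchiLanguage.finite_quotient (hL : IsCoBuchiLanguage L) :
    Finite (Quotient (pairSetoid L)) := by
  obtain ⟨Q, A, ⟨hQ, -⟩, rfl⟩ := hL
  refine Finite.of_injective (fun c => profile A c.out) fun c c' h => ?_
  have h1 := cls_eq_of_profile_eq h
  unfold cls at h1
  rwa [Prod.mk.eta, Prod.mk.eta, Quotient.out_eq, Quotient.out_eq] at h1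

theorem IsCoBuchiLanguage.append_mem (hL : IsCoBuchiLanguage L) {u : List α} {w : Stream' α}
    (h : ∀ n, ¬ EquivBot L u (w.take n)) : u ++ₛ w ∈ L := by
  obtain ⟨Q, A, ⟨hQ, -⟩, rfl⟩ := hL
  exact append_mem_of_not_equivBot h

/-- Only finitely many sets of safe extensions occur, so one obtained by lengthening the past can be
chosen minimal. By `safeExt_subset`, minimality is exactly pointedness. -/
theorem IsCoBuchiLanguage.exists_pointed (hL : IsCoBuchiLanguage L) {u v : List α}
    (h : ¬ EquivBot L u v) :
    ∃ u₁ u₂, RightCongr L (u₁ ++ u₂) u ∧ Pointed L u₁ (u₂ ++ v) := by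
  have := hL.finite_quotient
  let F : Set (Set (List α)) := {S | ∃ u₁ u₂, RightCongr L (u₁ ++ u₂) u ∧
    ¬ EquivBot L u₁ (u₂ ++ v) ∧ S = safeExt L u₁ (u₂ ++ v)}
  have hF : F.Finite := by
    refine (Set.finite_range
      (fun c : Quotient (pairSetoid L) => safeExt L c.out.1 c.out.2)).subset ?_
    rintro _ ⟨u₁, u₂, -, -, rfl⟩
    exact ⟨cls L u₁ (u₂ ++ v), (cls_eq_iff.1 (Quotient.out_eq (cls L u₁ (u₂ ++ v)))).2⟩
  obtain ⟨S, hS⟩ := hF.exists_minimal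
    ⟨_, u, [], by rw [List.append_nil]; exact RightCongr.refl u, h, rfl⟩
  obtain ⟨u₁, u₂, h1, h2, rfl⟩ := hS.prop
  refine ⟨u₁, u₂, h1, h2, fun u₃ u₄ h3 h4 => ?_⟩
  have h5 := safeExt_subset h3 (u₂ ++ v)
  refine (hS.le_of_le ⟨u₃, u₄ ++ u₂, ?_, ?_, ?_⟩ h5).antisymm h5
  · rw [← List.append_assoc]
    exact (h3.append u₂).trans h1
  · rwa [List.append_assoc]
  · rw [List.append_assoc]

theorem IsCoBuchiLanguage.exists_pointed_congr (hL : IsCoBuchiLanguage L) (u : List α) :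
    ∃ u₁ u₂, Pointed L u₁ u₂ ∧ RightCongr L (u₁ ++ u₂) u := by
  obtain ⟨u₁, u₂, h1, h2⟩ := hL.exists_pointed (not_equivBot_nil u)
  rw [List.append_nil] at h2
  exact ⟨u₁, u₂, h2, h1⟩

theorem IsCoBuchiLanguage.exists_not_equivBot (hL : IsCoBuchiLanguage L) {w : Stream' α}
    (hw : w ∈ L) : ∃ n, ∀ m, ¬ EquivBot L (w.take n) ((w.drop n).take m) := by
  obtain ⟨Q, A, ⟨hQ, -⟩, rfl⟩ := hL
  obtain ⟨q₀, h0, st, rk, hrun, hacc⟩ := hw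
  obtain ⟨N, hN⟩ := hacc.exists_forall
  -- Between two positions with the same run state and the same reachable set, the factor is a safe
  -- cycle and preserves the residual, hence is a `Loop`.
  obtain ⟨c, hc⟩ := exists_frequently_of_finite
    (P := fun (c : Q × Set Q) k => (st k, A.reach (w.take k)) = c) fun k => ⟨_, rfl⟩
  obtain ⟨n, hn, hnc⟩ := hc N
  refine ⟨n, fun m => ?_⟩
  obtain ⟨k, hk, hkc⟩ := hc (n + (m + 1))
  obtain ⟨j, rfl⟩ := Nat.exists_eq_add_of_le hk
  rw [add_assoc n] at hkc
  have h3 := hkc.trans hnc.symm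
  rw [Prod.mk.injEq] at h3
  refine not_equivBot_of_prefix (x := (w.drop n).take (m + 1 + j)) ?_
    (take_prefix_take _ (by omega))
  apply Loop.not_equivBot
  refine loop_of_path (A := A) (q := st n) ⟨q₀, h0, ?_⟩ ?_ (fun h => ?_) ?_
  · exact hrun.path_take n
  · have h4 := hrun.path_safe hN hn (m + 1 + j)
    rwa [h3.1] at h4
  · have := congrArg List.length h
    simp at this
  · rw [take_append_take_drop]
    exact congr_of_reach_eq h3.2

/-- Each prefix of the safe tail yields its own pointed pair. One class of (u₁, u₂) recurs for
arbitrarily long prefixes, so a single representative safely reads them all. -/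
theorem IsCoBuchiLanguage.exists_pointed_of_mem (hL : IsCoBuchiLanguage L) {w : Stream' α}
    (hw : w ∈ L) : ∃ n u v, Pointed L u v ∧ RightCongr L (u ++ v) (w.take n) ∧
      ∀ m, (w.drop n).take m ∈ safeExt L u v := by
  have := hL.finite_quotient
  obtain ⟨n, hn⟩ := hL.exists_not_equivBot hw
  have h1 : ∀ m, ∃ c : Quotient (pairSetoid L), ∃ u₁ u₂, RightCongr L (u₁ ++ u₂) (w.take n) ∧
      Pointed L u₁ (u₂ ++ (w.drop n).take m) ∧ c = cls L u₁ u₂ := by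
    intro m
    obtain ⟨u₁, u₂, h1, h2⟩ := hL.exists_pointed (hn m)
    exact ⟨_, u₁, u₂, h1, h2, rfl⟩
  obtain ⟨c, hc⟩ := exists_frequently_of_finite h1
  obtain ⟨k, -, u₁, u₂, hu, hp, rfl⟩ := hc 0
  refine ⟨n + k, u₁, u₂ ++ (w.drop n).take k, hp, ?_, fun m => ?_⟩
  · rw [← List.append_assoc, ← take_append_take_drop]
    exact hu.append _
  · rw [mem_safeExt, List.append_assoc]
    obtain ⟨l, hl, u₃, u₄, -, hp', he⟩ := hc (k + m)
    have h2 : (w.drop n).take l ∈ safeExt L u₁ u₂ := by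
      rw [(cls_eq_iff.1 he).2]
      exact hp'.1
    refine not_equivBot_of_prefix h2 ((List.prefix_append_right_inj _).2 ?_)
    rw [← Stream'.drop_drop, take_append_take_drop]
    exact take_prefix_take _ hl

end CoBuchiLanguage

/-! ### The canonical automaton is total and accepts only words of L -/

section CanonicalAutomaton

variable {α : Type*} {L : Set (Stream' α)}

/-- The state of the canonical automaton given by a pointed pair. -/
def Pointed.state {u v : List α} (h : Pointed L u v) : CanonicalState L :=
  ⟨cls L u v, u, v, h, rfl⟩

namespace CanonicalState

/-- The first component of a pointed representative. -/
noncomputable def fst (p : CanonicalState L) : List α := p.2.choose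

/-- The second component of a pointed representative. -/
noncomputable def snd (p : CanonicalState L) : List α := p.2.choose_spec.choose

theorem pointed (p : CanonicalState L) : Pointed L p.fst p.snd :=
  p.2.choose_spec.choose_spec.1

theorem eq_cls (p : CanonicalState L) : p.1 = cls L p.fst p.snd :=
  p.2.choose_spec.choose_spec.2

theorem finite (hL : IsCoBuchiLanguage L) : Finite (CanonicalState L) := by
  have := hL.finite_quotient
  exact Subtype.finite

end CanonicalState

theorem canonical_trans_congr {p q : CanonicalState L} {a : α} {i : Rank}
    (h : (canonical L).trans p a i q) {u v u' v' : List α} (hp : p.1 = cls L u v)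
    (hq : q.1 = cls L u' v') : RightCongr L (u ++ v ++ [a]) (u' ++ v') := by
  cases i with
  | one =>
    obtain ⟨u₁, v₁, u₂, v₂, -, h1, -, h2, h3⟩ := h
    have h4 := (cls_eq_iff.1 (hp.symm.trans h1)).1
    have h5 := (cls_eq_iff.1 (h2.symm.trans hq)).1
    exact ((h4.append [a]).trans h3).trans h5
  | two =>
    obtain ⟨u₁, v₁, -, h1, -, h2⟩ := h
    have h4 := (cls_eq_iff.1 (hp.symm.trans h1)).1
    have h5 := (cls_eq_iff.1 (h2.symm.trans hq)).1
    rw [← List.append_assoc] at h5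
    exact (h4.append [a]).trans h5

theorem cons_mem_safeExt_of_trans {p q : CanonicalState L} {a : α}
    (h : (canonical L).trans p a Rank.two q) {x : List α} (hx : x ∈ safeExt L q.fst q.snd) :
    a :: x ∈ safeExt L p.fst p.snd := by
  obtain ⟨u, v, -, h1, -, h2⟩ := h
  rw [(cls_eq_iff.1 (q.eq_cls.symm.trans h2)).2, mem_safeExt, List.append_assoc] at hx
  rw [(cls_eq_iff.1 (p.eq_cls.symm.trans h1)).2]
  exact hx

/-- Every transition tracks the residual. Safe extensions pull back along rank-2 transitions, so
from the last rank-1 transition on, every prefix of the tail is safe for the current state. -/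
theorem canonical_language_subset (hL : IsCoBuchiLanguage L) : (canonical L).language ⊆ L := by
  rintro w ⟨q₀, hq₀, st, rk, ⟨h0, hrun⟩, hacc⟩
  obtain ⟨N, hN⟩ := hacc.exists_forall
  have hcongr : ∀ n, RightCongr L ((st n).fst ++ (st n).snd) (w.take n) := by
    intro n
    induction n with
    | zero =>
      obtain ⟨u, v, -, h1, h2⟩ := hq₀
      rw [← h0, (st 0).eq_cls] at h1
      exact (cls_eq_iff.1 h1).1.trans h2
    | succ n ih =>
      rw [Stream'.take_succ']
      exact (canonical_trans_congr (hrun n) (st n).eq_cls (st (n + 1)).eq_cls).symm.trans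
        (ih.append _)
  have hsafe : ∀ m n, N ≤ n → (w.drop n).take m ∈ safeExt L (st n).fst (st n).snd := by
    intro m
    induction m with
    | zero =>
      intro n _
      rw [Stream'.take_zero, mem_safeExt, List.append_nil]
      exact (st n).pointed.1
    | succ m ih =>
      intro n hn
      have h1 := hrun n
      rw [hN n hn] at h1
      have h2 := cons_mem_safeExt_of_trans h1 (ih (n + 1) (by omega))
      rwa [Stream'.take_succ, Stream'.head_drop, Stream'.tail_drop']
  have h1 : (st N).fst ++ₛ ((st N).snd ++ₛ w.drop N) ∈ L := by
    refine hL.append_mem fun n => not_equivBot_of_prefix (hsafe n N le_rfl) ?_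
    rw [Stream'.append_take]
    exact take_prefix_take _ (by omega)
  rw [← Stream'.append_append_stream] at h1
  have h2 := (hcongr N _).1 h1
  rwa [Stream'.append_take_drop] at h2

theorem canonical_isCoBuchi (hL : IsCoBuchiLanguage L) : (canonical L).IsCoBuchi := by
  refine ⟨CanonicalState.finite hL, fun p a => ?_⟩
  obtain ⟨u, v, h1, h2⟩ := hL.exists_pointed_congr (p.fst ++ p.snd ++ [a])
  exact ⟨Rank.one, h1.state, p.fst, p.snd, u, v, p.pointed, p.eq_cls, h1, rfl, h2.symm⟩

end CanonicalAutomaton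

/-! ### Eve's strategy: follow the oldest surviving candidate -/

section Strategy

variable {α : Type*} {L : Set (Stream' α)}

/-- Given an enumeration `f` of states in blocks of length `k`, the state `f N` placed after the
first `N / k` letters of `x` has the right residual and safely reads the remaining letters. -/
def Alive (k : ℕ) (f : ℕ → CanonicalState L) (x : List α) (N : ℕ) : Prop :=
  N / k ≤ x.length ∧ RightCongr L ((f N).fst ++ (f N).snd) (x.take (N / k)) ∧
    x.drop (N / k) ∈ safeExt L (f N).fst (f N).snd

/-- The least index which is alive. -/
noncomputable def token (k : ℕ) (f : ℕ → CanonicalState L) (x : List α) : ℕ :=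
  sInf {N | Alive k f x N}

variable {k : ℕ} {f : ℕ → CanonicalState L}

theorem alive_token (hL : IsCoBuchiLanguage L) (hf : ∀ p m, ∃ N, N / k = m ∧ f N = p)
    (x : List α) : Alive k f x (token k f x) := by
  refine Nat.sInf_mem (s := {N | Alive k f x N}) ?_
  obtain ⟨u, v, h1, h2⟩ := hL.exists_pointed_congr x
  obtain ⟨N, hN, hp⟩ := hf h1.state x.length
  refine ⟨N, hN.le, ?_, ?_⟩
  · rw [hN, List.take_length]
    refine RightCongr.trans (cls_eq_iff.1 ((f N).eq_cls.symm.trans ?_)).1 h2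
    rw [hp]
    rfl
  · rw [hN, List.drop_length, mem_safeExt, List.append_nil]
    exact (f N).pointed.1

theorem token_le {x : List α} {N : ℕ} (h : Alive k f x N) : token k f x ≤ N :=
  Nat.sInf_le h

/-- A dead candidate never revives, and one started only after the new letter has a larger index
than any candidate already started. -/
theorem token_le_append (hL : IsCoBuchiLanguage L) (hf : ∀ p m, ∃ N, N / k = m ∧ f N = p)
    (x : List α) (a : α) : token k f x ≤ token k f (x ++ [a]) := by
  obtain ⟨h1, h2, h3⟩ := alive_token hL hf (x ++ [a])
  by_cases h : token k f (x ++ [a]) / k ≤ x.length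
  · refine token_le ⟨h, ?_, ?_⟩
    · rwa [List.take_append_of_le_length h] at h2
    · rw [List.drop_append_of_le_length h, mem_safeExt, ← List.append_assoc] at h3
      exact not_equivBot_of_append h3
  · by_contra hlt
    have h4 := Nat.div_le_div_right (c := k) (not_le.1 hlt).le
    exact h (h4.trans (alive_token hL hf x).1)

theorem Alive.pointed {x : List α} {N : ℕ} (h : Alive k f x N) :
    Pointed L (f N).fst ((f N).snd ++ x.drop (N / k)) :=
  (f N).pointed.append h.2.2

theorem Alive.congr {x : List α} {N : ℕ} (h : Alive k f x N) :
    RightCongr L ((f N).fst ++ ((f N).snd ++ x.drop (N / k))) x := by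
  have h1 := h.2.1.append (x.drop (N / k))
  rwa [List.take_append_drop, List.append_assoc] at h1

-- Rank 1 is taken exactly when the token changes. The token never decreases, and on a word of L it
-- is bounded by the index of an immortal candidate, so it stabilises.
open Classical in
theorem canonical_strategy (hL : IsCoBuchiLanguage L)
    (hf : ∀ p m, ∃ N, N / k = m ∧ f N = p) :
    ∃ q₀ ∈ (canonical L).init, ∃ σ : List α → α → Rank × CanonicalState L, ∀ w : Stream' α,
      (canonical L).IsRun q₀ w (Automaton.playState q₀ σ w) (Automaton.playRank σ w) ∧
        (w ∈ L → Automaton.Accepting (Automaton.playRank σ w)) := by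
  let S : List α → CanonicalState L := fun x => (alive_token hL hf x).pointed.state
  let σ : List α → α → Rank × CanonicalState L := fun x a =>
    (if token k f (x ++ [a]) = token k f x then Rank.two else Rank.one, S (x ++ [a]))
  have htrans : ∀ x a, (canonical L).trans (S x) a (σ x a).1 (S (x ++ [a])) := by
    intro x a
    have hx := alive_token hL hf x
    have hxa := alive_token hL hf (x ++ [a])
    by_cases h : token k f (x ++ [a]) = token k f x
    · have hr : (σ x a).1 = Rank.two := if_pos h
      rw [hr]
      have hn := hxa.pointed.1
      have he : (S (x ++ [a])).1 = cls L (f (token k f (x ++ [a]))).fst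
        ((f (token k f (x ++ [a]))).snd ++ (x ++ [a]).drop (token k f (x ++ [a]) / k)) := rfl
      rw [h, List.drop_append_of_le_length hx.1, ← List.append_assoc] at hn he
      exact ⟨_, _, hx.pointed, rfl, hn, he⟩
    · have hr : (σ x a).1 = Rank.one := if_neg h
      rw [hr]
      exact ⟨_, _, _, _, hx.pointed, rfl, hxa.pointed, rfl, (hx.congr.append [a]).trans
        hxa.congr.symm⟩
  have hstate : ∀ w n, Automaton.playState (S []) σ w n = S (w.take n) := by
    intro w n
    cases n with
    | zero => rfl
    | succ n =>
      rw [Stream'.take_succ']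
      rfl
  refine ⟨S [], ⟨_, _, (alive_token hL hf []).pointed, rfl, (alive_token hL hf []).congr⟩, σ,
    fun w => ⟨⟨rfl, fun n => ?_⟩, fun hw => ?_⟩⟩
  · rw [hstate, hstate, Stream'.take_succ']
    exact htrans _ _
  · obtain ⟨n, u, v, h1, h2, h3⟩ := hL.exists_pointed_of_mem hw
    obtain ⟨N, hN, hp⟩ := hf h1.state n
    have hcls : cls L (f N).fst (f N).snd = cls L u v := by
      rw [← CanonicalState.eq_cls, hp]
      rfl
    rw [cls_eq_iff] at hcls
    have halive : ∀ m, Alive k f (w.take (n + m)) N := by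
      intro m
      rw [← take_append_take_drop]
      have hlen : (w.take n).length = n := Stream'.length_take _ _
      refine ⟨?_, ?_, ?_⟩
      · rw [hN, List.length_append, hlen]
        omega
      · rw [hN, List.take_left' hlen]
        exact hcls.1.trans h2
      · rw [hN, List.drop_left' hlen, hcls.2]
        exact h3 m
    have hmono : Monotone fun m => token k f (w.take m) := monotone_nat_of_le_succ fun m => by
      rw [Stream'.take_succ']
      exact token_le_append hL hf _ _
    have hle : ∀ m, token k f (w.take m) ≤ N := fun m =>
      (hmono (Nat.le_add_left m n)).trans (token_le (halive m))
    obtain ⟨c, hc⟩ := exists_frequently_of_finite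
      (P := fun (c : Fin (N + 1)) m => token k f (w.take m) = c)
      fun m => ⟨⟨_, Nat.lt_succ_of_le (hle m)⟩, rfl⟩
    obtain ⟨M, -, hM⟩ := hc 0
    have hconst : ∀ m, M ≤ m → token k f (w.take m) = c := by
      intro m hm
      obtain ⟨l, hl, hlc⟩ := hc m
      exact le_antisymm (hlc ▸ hmono hl) (hM ▸ hmono hm)
    refine Automaton.accepting_of_forall (N := M) fun m hm => if_pos ?_
    rw [← Stream'.take_succ', hconst m hm, hconst (m + 1) (by omega)]

theorem canonical_isHDFor (hL : IsCoBuchiLanguage L) : (canonical L).IsHDFor L := by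
  have := CanonicalState.finite hL
  obtain ⟨u, v, h, -⟩ := hL.exists_pointed_congr []
  obtain ⟨k, ⟨e⟩⟩ := Finite.exists_equiv_fin (CanonicalState L)
  have hk : 0 < k := (Nat.zero_le _).trans_lt (e h.state).2
  obtain ⟨q₀, hq₀, σ, hσ⟩ := canonical_strategy (k := k)
    (f := fun N => e.symm ⟨N % k, Nat.mod_lt _ hk⟩) hL fun p m => by
      -- With k the number of states, the block of indices N with N / k = m lists every state once.
      refine ⟨k * m + e p, ?_, ?_⟩
      · rw [Nat.mul_add_div hk, Nat.div_eq_of_lt (e p).2, add_zero]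
      · rw [Equiv.symm_apply_eq]
        ext
        simp [Nat.mod_eq_of_lt (e p).2]
  have hsub := canonical_language_subset hL
  refine ⟨canonical_isCoBuchi hL,
    ⟨q₀, hq₀, σ, fun w => ⟨(hσ w).1, fun hw => (hσ w).2 (hsub hw)⟩⟩, hsub.antisymm ?_⟩
  exact fun w hw => ⟨q₀, hq₀, _, _, (hσ w).1, (hσ w).2 hw⟩

end Strategy

/-! ### Histories played by a strategy -/

section Play

open Automaton

variable {α Q : Type*} {B : Automaton α Q} {q₀ : Q} {σ : List α → α → Rank × Q}

/-- The state reached by a strategy after a history. -/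
def stateAfter (q₀ : Q) (σ : List α → α → Rank × Q) (h : List α) : Q :=
  if hn : h = [] then q₀ else (σ h.dropLast (h.getLast hn)).2

theorem playState_eq (w : Stream' α) (n : ℕ) :
    playState q₀ σ w n = stateAfter q₀ σ (w.take n) := by
  cases n with
  | zero => rfl
  | succ n =>
    have hn : w.take n ++ [w.get n] ≠ [] := List.append_ne_nil_of_right_ne_nil _ (List.cons_ne_nil _ _)
    rw [Stream'.take_succ', stateAfter, dif_neg hn, List.dropLast_concat, List.getLast_concat]
    rfl

/-- After the history `h`, the strategy reads `x` along transitions of rank `2`. -/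
def SafeAfter (σ : List α → α → Rank × Q) (h x : List α) : Prop :=
  ∀ y a, y ++ [a] <+: x → (σ (h ++ y) a).1 = Rank.two

theorem SafeAfter.of_append_left {h x y : List α} (hs : SafeAfter σ h (x ++ y)) :
    SafeAfter σ h x :=
  fun z a hz => hs z a (hz.trans (List.prefix_append _ _))

theorem SafeAfter.of_append_right {h x y : List α} (hs : SafeAfter σ h (x ++ y)) :
    SafeAfter σ (h ++ x) y := by
  intro z a hz
  rw [List.append_assoc]
  apply hs
  rw [List.append_assoc]
  exact (List.prefix_append_right_inj x).2 hz

theorem trans_stateAfter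
    (hσ : ∀ w : Stream' α, B.IsRun q₀ w (playState q₀ σ w) (playRank σ w))
    (h : List α) (a : α) :
    B.trans (stateAfter q₀ σ h) a (σ h a).1 (stateAfter q₀ σ (h ++ [a])) := by
  -- The hypothesis concerns infinite words; this one realises the history h followed by the letter
  -- a.
  let w : Stream' α := h ++ₛ Stream'.const a
  have h1 : w.take h.length = h := take_length_append _ _
  have h2 : w.get h.length = a := by
    have h3 : (w.drop h.length).get 0 = a := by rw [Stream'.drop_append_stream]; rfl
    rwa [Stream'.get_drop] at h3
  have h4 := (hσ w).2 h.length
  rw [playState_eq, playState_eq, Stream'.take_succ', playRank, h1, h2] at h4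
  exact h4

theorem path_stateAfter
    (hσ : ∀ w : Stream' α, B.IsRun q₀ w (playState q₀ σ w) (playRank σ w))
    (h x : List α) :
    Path B.step (stateAfter q₀ σ h) x (stateAfter q₀ σ (h ++ x)) := by
  induction x generalizing h with
  | nil => simp
  | cons a x ih =>
    have h1 := ih (h ++ [a])
    rw [List.append_assoc] at h1
    exact ⟨_, ⟨_, trans_stateAfter hσ h a⟩, h1⟩

theorem stateAfter_mem_reach
    (hσ : ∀ w : Stream' α, B.IsRun q₀ w (playState q₀ σ w) (playRank σ w))
    (hq₀ : q₀ ∈ B.init) (h : List α) :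
    stateAfter q₀ σ h ∈ B.reach h :=
  ⟨q₀, hq₀, path_stateAfter hσ [] h⟩

theorem SafeAfter.path
    (hσ : ∀ w : Stream' α, B.IsRun q₀ w (playState q₀ σ w) (playRank σ w))
    {h x : List α}
    (hs : SafeAfter σ h x) :
    Path B.safeStep (stateAfter q₀ σ h) x (stateAfter q₀ σ (h ++ x)) := by
  induction x generalizing h with
  | nil => simp
  | cons a x ih =>
    have h1 := ih (h := h ++ [a]) (SafeAfter.of_append_right (x := [a]) hs)
    rw [List.append_assoc] at h1
    refine ⟨_, ?_, h1⟩
    have h2 := trans_stateAfter hσ h a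
    have h3 := hs [] a (List.prefix_append [a] x)
    rw [List.append_nil] at h3
    rwa [h3] at h2

/-- If hw is accepted, the winning play gives an accepting run on w from the state after h, and h'
reaches that same state. -/
theorem congr_of_stateAfter_eq
    (hσ : ∀ w : Stream' α, B.IsRun q₀ w (playState q₀ σ w) (playRank σ w))
    (hq₀ : q₀ ∈ B.init)
    (hacc : ∀ w ∈ B.language, Accepting (playRank σ w)) {h h' : List α}
    (he : stateAfter q₀ σ h = stateAfter q₀ σ h') : RightCongr B.language h h' := by
  have key : ∀ {h h' : List α}, stateAfter q₀ σ h = stateAfter q₀ σ h' → ∀ w,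
      h ++ₛ w ∈ B.language → h' ++ₛ w ∈ B.language := by
    intro h h' he w hw
    have h1 := (hσ (h ++ₛ w)).accFrom (hacc _ hw)
    rw [playState_eq, take_length_append, he] at h1
    exact h1.append_mem (stateAfter_mem_reach hσ hq₀ h')
  exact fun w => ⟨key he w, key he.symm w⟩

end Play

/-! ### Recurrent states and the lower bound -/

section Minimality

open Automaton

variable {α : Type*} {L : Set (Stream' α)}

theorem Loop.double {u z : List α} (h : Loop L u z) : Loop L u (z ++ z) := by
  obtain ⟨h1, hz, h2⟩ := h
  have hz' : z ++ z ≠ [] := fun h => hz (List.append_eq_nil_iff.1 h).1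
  refine ⟨?_, hz', ?_⟩
  · rw [← List.append_assoc]
    exact (h1.append z).trans h1
  · have hc := Stream'.cycle_eq z hz
    rwa [eq_of_eq_append hz' (Stream'.cycle_eq _ hz') (t := Stream'.cycle z hz)]
    rw [Stream'.append_append_stream, ← hc, ← hc]

/-- `t` leads from the class of `u` back to it, and `v` can still be read safely afterwards. -/
def Return (L : Set (Stream' α)) (u v t : List α) : Prop :=
  RightCongr L (u ++ t) u ∧ ¬ EquivBot L u (t ++ v)

theorem Return.safeExt_eq {u v t : List α} (h : Return L u v t) (hp : Pointed L u v) :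
    safeExt L u v = safeExt L u (t ++ v) :=
  hp.2 u t h.1 h.2

theorem Return.exists_append {u v t x : List α} (h : Return L u v t) (hp : Pointed L u v)
    (hx : x ∈ safeExt L u v) : ∃ y, Return L u v (t ++ (v ++ (x ++ y))) := by
  have hx' := hx
  rw [h.safeExt_eq hp, mem_safeExt, not_equivBot_iff] at hx'
  rcases hx' with h1 | ⟨y, hy⟩
  · simp only [List.append_eq_nil_iff] at h1
    obtain ⟨⟨rfl, rfl⟩, rfl⟩ := h1
    exact ⟨[], h⟩
  · refine ⟨y ++ t, ?_, ?_⟩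
    · have h1 := (hy.1.append t).trans h.1
      simpa only [List.append_assoc] using h1
    -- With z = tvxy a loop, the word tvxytv is a prefix of zz.
    · refine not_equivBot_of_prefix hy.double.not_equivBot ?_
      exact ⟨x ++ y, by simp only [List.append_assoc]⟩

variable {Q : Type*} {B : Automaton α Q} {q₀ : Q} {σ : List α → α → Rank × Q}

/-- Otherwise each return extends to a longer one during which the strategy takes rank 1. The limit
word has only safe prefixes after u, so it lies in L after u, yet the strategy takes rank 1
infinitely often on it. -/
theorem exists_return_safeAfter (hL : IsCoBuchiLanguage L)
    (hacc : ∀ w ∈ L, Accepting (playRank σ w)) {u v : List α} (hp : Pointed L u v) :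
    ∃ t, Return L u v t ∧ ∀ x ∈ safeExt L u v, SafeAfter σ (u ++ t) (v ++ x) := by
  by_contra hc
  push Not at hc
  have step : ∀ t, Return L u v t → ∃ s, Return L u v (t ++ s) ∧ ¬ SafeAfter σ (u ++ t) s := by
    intro t ht
    obtain ⟨x, hx, hs⟩ := hc t ht
    obtain ⟨y, hy⟩ := ht.exists_append hp hx
    refine ⟨_, hy, fun h => hs ?_⟩
    rw [← List.append_assoc] at h
    exact h.of_append_left
  choose! F hF1 hF2 using step
  let t : ℕ → List α := fun n => Nat.rec [] (fun _ t => t ++ F t) n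
  have ht : ∀ n, Return L u v (t n) := by
    intro n
    induction n with
    | zero => exact ⟨by simpa [t] using RightCongr.refl u, hp.1⟩
    | succ n ih => exact hF1 _ ih
  have hne : ∀ n, 0 < (F (t n)).length := by
    intro n
    rw [List.length_pos_iff]
    intro h
    refine hF2 _ (ht n) fun y a hy => ?_
    rw [h] at hy
    simp at hy
  have hlt : ∀ n, (t n).length < (t (n + 1)).length := by
    intro n
    have h1 : (t (n + 1)).length = (t n).length + (F (t n)).length := List.length_append
    have := hne n
    omega
  have hlen : ∀ n, n ≤ (t n).length := fun n =>
    (strictMono_nat_of_lt_succ (f := fun n => (t n).length) hlt).le_apply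
  obtain ⟨w, hw⟩ := exists_limit t (fun n => List.prefix_append _ _) hlt
  have hwL : u ++ₛ w ∈ L := by
    refine hL.append_mem fun n => not_equivBot_of_prefix (ht n).2 ?_
    rw [← hw n]
    exact (take_prefix_take _ (hlen n)).trans (List.prefix_append _ _)
  obtain ⟨N, hN⟩ := (hacc _ hwL).exists_forall
  refine hF2 _ (ht N) fun y a hy => ?_
  have h1 : (u ++ t N) ++ y ++ [a] <+: u ++ t (N + 1) := by
    simp only [List.append_assoc]
    exact (List.prefix_append_right_inj u).2 ((List.prefix_append_right_inj (t N)).2 hy)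
  have h2 : (u ++ₛ w).take ((u ++ t N ++ y).length + 1) = u ++ t N ++ y ++ [a] := by
    have h3 : u ++ t (N + 1) = (u ++ₛ w).take (u.length + (t (N + 1)).length) := by
      rw [← Stream'.append_take, hw (N + 1)]
    rw [h3] at h1
    have h4 := take_prefix_take (u ++ₛ w) (m := (u ++ t N ++ y ++ [a]).length)
      (n := u.length + (t (N + 1)).length) (by simpa using h1.length_le)
    have h5 := (List.prefix_of_prefix_length_le h4 h1 (by simp)).eq_of_length (by simp)
    simpa only [List.length_append, List.length_singleton] using h5
  rw [Stream'.take_succ'] at h2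
  obtain ⟨h3, h4⟩ := List.append_inj' h2 rfl
  have h5 := hN (u ++ t N ++ y).length (by
    have := hlen N
    simp only [List.length_append]
    omega)
  rw [playRank, h3, List.singleton_inj.1 h4] at h5
  exact h5

/-- Every pointed pair has a state of a history-deterministic automaton to which a winning
strategy returns along safe loops, after every safe extension. -/
theorem exists_recurrent [Finite Q] (hL : IsCoBuchiLanguage L)
    (hσ : ∀ w : Stream' α, B.IsRun q₀ w (playState q₀ σ w) (playRank σ w))
    (hacc : ∀ w ∈ L, Accepting (playRank σ w)) {u v : List α} (hp : Pointed L u v) :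
    ∃ q h, RightCongr L h (u ++ v) ∧ stateAfter q₀ σ h = q ∧
      ∀ x ∈ safeExt L u v, ∃ y, RightCongr L (u ++ (v ++ (x ++ y))) u ∧
        Path B.safeStep q (x ++ (y ++ v)) q := by
  -- Proper extensions start with v because states are compared after utv: passing from t to tvs
  -- then reads sv between the two states.
  let Ext : List α → List α → Prop := fun t t' => t' = t ∨ ∃ s, t' = t ++ (v ++ s)
  have ext_trans : ∀ {t t' t''}, Ext t t' → Ext t' t'' → Ext t t'' := by
    rintro t t' t'' (rfl | ⟨s, rfl⟩) (rfl | ⟨s', rfl⟩)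
    · exact Or.inl rfl
    · exact Or.inr ⟨s', rfl⟩
    · exact Or.inr ⟨s, rfl⟩
    · exact Or.inr ⟨s ++ (v ++ s'), by simp only [List.append_assoc]⟩
  let Good : List α → Prop := fun t =>
    Return L u v t ∧ ∀ x ∈ safeExt L u v, SafeAfter σ (u ++ t) (v ++ x)
  have mem_of : ∀ {t s}, Return L u v t → Return L u v (t ++ (v ++ s)) →
      s ++ v ∈ safeExt L u v := by
    intro t s ht hs
    rw [ht.safeExt_eq hp, mem_safeExt]
    have := hs.2
    simpa only [List.append_assoc] using this
  have good_ext : ∀ {t t'}, Good t → Ext t t' → Return L u v t' → Good t' := by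
    rintro t t' ht (rfl | ⟨s, rfl⟩) hr
    · exact ht
    · refine ⟨hr, fun x hx => ?_⟩
      have h1 : s ++ (v ++ x) ∈ safeExt L u v := by
        rw [hr.safeExt_eq hp, mem_safeExt] at hx
        rw [ht.1.safeExt_eq hp, mem_safeExt]
        simpa only [List.append_assoc] using hx
      have h2 := ht.2 _ h1
      rw [← List.append_assoc] at h2
      have h3 := h2.of_append_right
      simpa only [List.append_assoc] using h3
  let R : List α → Set Q := fun t =>
    {q | ∃ t', Ext t t' ∧ Return L u v t' ∧ stateAfter q₀ σ (u ++ t' ++ v) = q}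
  obtain ⟨t₀, ht₀⟩ := exists_return_safeAfter hL hacc hp
  -- Extending t shrinks `R t`; at a minimal value, every state in it stays reachable after any
  -- further return, as in a bottom component.
  obtain ⟨_, ⟨⟨t, ht, rfl⟩, hmin⟩⟩ :=
    (Set.toFinite {S | ∃ t, Good t ∧ R t = S}).exists_minimal ⟨_, t₀, ht₀, rfl⟩
  have hrec : ∀ t', Ext t t' → Return L u v t' → ∃ t'', Ext t' t'' ∧ Return L u v t'' ∧
      stateAfter q₀ σ (u ++ t'' ++ v) = stateAfter q₀ σ (u ++ t ++ v) := by
    intro t' he hr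
    have hsub : R t' ⊆ R t := by
      rintro q ⟨t'', h1, h2⟩
      exact ⟨t'', ext_trans he h1, h2⟩
    exact hmin ⟨t', good_ext ht he hr, rfl⟩ hsub ⟨t, Or.inl rfl, ht.1, rfl⟩
  refine ⟨_, u ++ t ++ v, ht.1.1.append v, rfl, fun x hx => ?_⟩
  obtain ⟨y₁, h1⟩ := ht.1.exists_append hp hx
  obtain ⟨t'', h2, h3, h4⟩ := hrec _ (Or.inr ⟨_, rfl⟩) h1
  obtain ⟨y, rfl⟩ : ∃ y, t'' = t ++ (v ++ (x ++ y)) := by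
    rcases h2 with rfl | ⟨s, rfl⟩
    · exact ⟨y₁, rfl⟩
    · exact ⟨y₁ ++ (v ++ s), by simp only [List.append_assoc]⟩
  refine ⟨y, ?_, ?_⟩
  · have h5 := ht.1.1.symm.append (v ++ (x ++ y))
    refine h5.trans ?_
    simpa only [List.append_assoc] using h3.1
  · have h5 := (ht.2 _ (mem_of ht.1 h3)).of_append_right.path hσ
    have h6 : u ++ t ++ v ++ (x ++ y ++ v) = u ++ (t ++ (v ++ (x ++ y))) ++ v := by
      simp only [List.append_assoc]
    rwa [h6, h4, List.append_assoc x] at h5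

theorem card_canonicalState_le [Finite Q] (hL : IsCoBuchiLanguage L) (hB : B.IsHDFor L) :
    Nat.card (CanonicalState L) ≤ Nat.card Q := by
  obtain ⟨-, ⟨q₀, hq₀, σ, hσ⟩, rfl⟩ := hB
  have hrun := fun w => (hσ w).1
  have hacc := fun w => (hσ w).2
  choose g h hcongr hstate hloop using fun p : CanonicalState B.language =>
    exists_recurrent hL hrun hacc p.pointed
  have hsub : ∀ p p', g p = g p' → RightCongr B.language (p.fst ++ p.snd) (p'.fst ++ p'.snd) ∧
      safeExt B.language p.fst p.snd ⊆ safeExt B.language p'.fst p'.snd := by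
    intro p p' he
    have hc : RightCongr B.language (h p) (h p') :=
      congr_of_stateAfter_eq hrun hq₀ hacc (by rw [hstate, hstate, he])
    have hc' := ((hcongr p).symm.trans hc).trans (hcongr p')
    refine ⟨hc', fun x hx => ?_⟩
    -- The empty word is safe by convention and may produce no non-empty loop.
    by_cases hn : p'.snd ++ x = []
    · rw [mem_safeExt, hn]
      exact not_equivBot_nil _
    obtain ⟨y, h1, h2⟩ := hloop p x hx
    have hnil : [] ∈ safeExt B.language p'.fst p'.snd := by
      rw [mem_safeExt, List.append_nil]
      exact p'.pointed.1
    obtain ⟨y', h3, h4⟩ := hloop p' [] hnil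
    rw [List.nil_append] at h3 h4
    rw [he] at h2
    have hxyv : RightCongr B.language (h p' ++ (x ++ (y ++ p.snd))) (p'.fst ++ p'.snd) := by
      have h5 := (((hcongr p').trans hc'.symm).append (x ++ (y ++ p.snd)))
      refine (h5.trans ?_).trans hc'
      have h6 := h1.append p.snd
      simpa only [List.append_assoc] using h6
    have hback : RightCongr B.language (h p' ++ (x ++ (y ++ (p.snd ++ y')))) p'.fst := by
      have h5 := hxyv.append y'
      simp only [List.append_assoc] at h5
      exact h5.trans h3
    -- The loop of p through x, followed by a loop of p', is a safe cycle at the shared state.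
    -- Rotated to start at `p'.fst`, it begins with `p'.snd ++ x`.
    have hl : Loop B.language (h p') ((x ++ (y ++ (p.snd ++ y'))) ++ p'.snd) := by
      refine loop_of_path (q := g p') ?_ ?_ (fun h => hn ?_) ?_
      · rw [← hstate]
        exact stateAfter_mem_reach hrun hq₀ _
      · have h5 := h2.trans h4
        simpa only [List.append_assoc] using h5
      · simp only [List.append_eq_nil_iff] at h ⊢
        exact ⟨h.2, h.1.1⟩
      · have h5 := (hback.append p'.snd).trans (hcongr p').symm
        simpa only [List.append_assoc] using h5
    have h5 := (hl.rotate hback).not_equivBot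
    rw [← List.append_assoc] at h5
    exact not_equivBot_of_append h5
  refine Nat.card_le_card_of_injective g fun p p' he => ?_
  apply Subtype.ext
  rw [p.eq_cls, p'.eq_cls, cls_eq_iff]
  exact ⟨(hsub p p' he).1, (hsub p p' he).2.antisymm (hsub p' p he.symm).2⟩

end Minimality

end CoBuchi

theorem theorem3p8 {α : Type*} [Finite α] [Nonempty α] (L : Set (Stream' α))
    (hL : CoBuchi.IsCoBuchiLanguage L) :
    (CoBuchi.canonical L).IsHDFor L ∧
      ∀ (Q : Type*) (B : CoBuchi.Automaton α Q), B.IsHDFor L →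
        Nat.card (CoBuchi.CanonicalState L) ≤ Nat.card Q := by
  refine ⟨CoBuchi.canonical_isHDFor hL, fun Q B hB => ?_⟩
  have := hB.1.1
  exact CoBuchi.card_canonicalState_le hL hB
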